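/- Let $\lambda>0$ and $d\mu(t)=\operatorname{sh}^{2\lambda}t\,dt$ on $[0,\infty)$; write $|E|_\lambda=\mu(E)$ for measurable $E\subset[0,\infty)$. For $1\le p<\infty$ let $L_{p,\lambda}[0,\infty)$ be the space of functions $f$ on $[1,\infty)$ such that $t\mapsto f(\operatorname{ch}t)$ is measurable on $[0,\infty)$ and $$\|f\|_{L_{p,\lambda}}=\Big(\int_0^\infty|f(\operatorname{ch}t)|^p\operatorname{sh}^{2\lambda}t\,dt\Big)^{1/p}<\infty .$$ Let $$A^\lambda_{\operatorname{ch}t}f(\operatorname{ch}x)=\frac{\Gamma(\lambda+\frac12)}{\Gamma(\frac12)\Gamma(\lambda)}\int_0^\pi f(\operatorname{ch}x\operatorname{ch}t-\operatorname{sh}x\operatorname{sh}t\cos\varphi)(\sin\varphi)^{2\lambda-1}\,d\varphi$$ be the generalized (Gegenbauer) shift, and let $$M_Gf(\operatorname{ch}x)=\sup_{r>0}\frac1{\int_0^r\operatorname{sh}^{2\lambda}t\,dt}\int_0^rA^\lambda_{\operatorname{ch}t}|f|(\operatorname{ch}x)\,\operatorname{sh}^{2\lambda}t\,dt,\qquad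 x\in[0,\infty),$$ be the Gegenbauer maximal function. (a) There is a constant $c_\lambda>0$, depending only on $\lambda$, such that for all $f\in L_{1,\lambda}[0,\infty)$ and all $\alpha>0$ $$\big|\{x\in[0,\infty):M_Gf(\operatorname{ch}x)>\alpha\}\big|_\lambda\le\frac{c_\lambda}{\alpha}\int_0^\infty|f(\operatorname{ch}t)|\operatorname{sh}^{2\lambda}t\,dt=\frac{c_\lambda}{\alpha}\|f\|_{L_{1,\lambda}}.$$ (b) For every $1<p<\infty$ there is a constant $c_{\lambda,p}>0$, depending only on $\lambda$ and $p$, such that for all $f\in L_{p,\lambda}[0,\infty)$ one has $M_Gf\in L_{p,\lambda}[0,\infty)$ and $$\|M_Gf\|_{L_{p,\lambda}}\le c_{\lambda,p}\|f\|_{L_{p,\lambda}}.$$ -/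

import Mathlib

open MeasureTheory Set
open scoped ENNReal

noncomputable section

namespace Gegenbauer

/-- The measure `dμ(t) = sinh^{2λ} t dt` on the half-line `[0, ∞)`, viewed as a measure on `ℝ`
that vanishes outside `[0, ∞)`; `|E|_λ` is `gegMeasure lam E`. -/
def gegMeasure (lam : ℝ) : Measure ℝ :=
  (volume.restrict (Ici (0 : ℝ))).withDensity fun t => ENNReal.ofReal (Real.sinh t ^ (2 * lam))

/-- The interval `H(x, r) = (x - r, x + r) ∩ [0, ∞)`. -/
def ball (x r : ℝ) : Set ℝ := Ioo (x - r) (x + r) ∩ Ici 0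

/-- `f ∈ L_{p,λ}[0, ∞)`: the function `t ↦ f (cosh t)` is measurable on `[0, ∞)` and has finite
`L^p` norm with respect to `sinh^{2λ} t dt`. Only the values of `f` on `[1, ∞)` matter. -/
def MemL (p : ℝ≥0∞) (lam : ℝ) (f : ℝ → ℂ) : Prop :=
  MemLp (fun t => f (Real.cosh t)) p (gegMeasure lam)

/-- The norm of `L_{p,λ}[0, ∞)`, as an extended nonnegative number. -/
def normL (p : ℝ≥0∞) (lam : ℝ) (f : ℝ → ℂ) : ℝ≥0∞ :=
  eLpNorm (fun t => f (Real.cosh t)) p (gegMeasure lam)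

/-- The generalized shift `A_{cosh t}^λ F (cosh x)` of a nonnegative function `F` on `[1, ∞)`. -/
def shift (lam t : ℝ) (F : ℝ → ℝ≥0∞) (x : ℝ) : ℝ≥0∞ :=
  ENNReal.ofReal (Real.Gamma (lam + 1 / 2) / (Real.Gamma (1 / 2) * Real.Gamma lam)) *
    ∫⁻ φ in Ioo 0 Real.pi,
      F (Real.cosh x * Real.cosh t - Real.sinh x * Real.sinh t * Real.cos φ) *
        ENNReal.ofReal (Real.sin φ ^ (2 * lam - 1))

/-- The Gegenbauer maximal function, in the variable `x ∈ [0, ∞)`: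
`maximalG lam f x` is `M_G f (cosh x)`. -/
def maximalG (lam : ℝ) (f : ℝ → ℂ) (x : ℝ) : ℝ≥0∞ :=
  ⨆ (r : ℝ) (_ : 0 < r),
    (gegMeasure lam (ball 0 r))⁻¹ *
      ∫⁻ t in Ioo 0 r, shift lam t (fun z => ‖f z‖ₑ) x ∂(gegMeasure lam)

end Gegenbauer

end

/-!
The generalized shift averages a function over the third side `z` of a hyperbolic triangle with
sides `x` and `t`. In the variable `z` it is an integral operator with respect to the measure
`μ = sinh^{2λ} z dz`, and its kernel (`triangleKernel`) is symmetric in the three sides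
(`shift_eq_lintegral_triangleKernel`). Averaging the shift of `F` over `t ∈ (0, r)` is therefore
integrating `F` against `w(x, z) / μ(0, r)`, where `w(x, z)` (`ballShift`) is the shift of the
indicator function of the ball of radius `r` (`setLIntegral_shift_eq`). It vanishes for
`|x - z| ≥ r`, and otherwise it is the weighted measure of the angles `φ` with
`1 - cos φ < q = (cosh r - cosh (x - z)) / (sinh x sinh z)`, so that it is `O(min(1, q)^λ)`
(`exists_ballShift_le`).

This gives the weak type `(1, 1)` estimate in two regimes.

* If `r ≤ 1`, then `w(x, z) / μ(0, r)` is at most a constant times `1 / μ([x - r, x + r])`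
  (`exists_ballShift_mul_gegMeasure_Icc_le`), so the averages are controlled by the centered maximal
  function of `μ` on the line, which is of weak type `(1, 1)` by the Besicovitch covering theorem
  (`exists_measure_le_of_forall_exists_closedBall`).
* If `r ≥ 1`, where `μ` grows exponentially and is not doubling, then `w(x, z) / μ(0, r)` is at most
  a constant times `e^{-2λx}` (`exists_ballShift_mul_exp_le`). The averages are at most a constant
  times `e^{-2λx} ‖f‖₁`, and `μ {x ≤ X}` is at most `e^{2λX} / (2λ)`.

The strong type `(p, p)` estimate follows by Marcinkiewicz interpolation with the trivial `L^∞`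
bound (`exists_maximalG_le_add`, `lintegral_rpow_le_of_weak_type`).
-/

open MeasureTheory Set
open scoped ENNReal

noncomputable section

namespace Gegenbauer

/-! ### The measure -/

lemma measurable_density (lam : ℝ) :
    Measurable fun t : ℝ => ENNReal.ofReal (Real.sinh t ^ (2 * lam)) := by
  fun_prop

lemma lintegral_gegMeasure (lam : ℝ) (F : ℝ → ℝ≥0∞) :
    ∫⁻ t, F t ∂(gegMeasure lam) =
      ∫⁻ t in Ioi (0 : ℝ), ENNReal.ofReal (Real.sinh t ^ (2 * lam)) * F t := by
  rw [gegMeasure, lintegral_withDensity_eq_lintegral_mul_non_measurable _ (measurable_density lam)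
    (by simp), ← Measure.restrict_congr_set (Ioi_ae_eq_Ici (μ := volume) (a := (0 : ℝ)))]
  rfl

instance (lam : ℝ) : SigmaFinite (gegMeasure lam) := by
  unfold gegMeasure; infer_instance

instance (lam : ℝ) : NullSingletonClass (gegMeasure lam) := by
  unfold gegMeasure; infer_instance

lemma ae_pos (lam : ℝ) : ∀ᵐ x ∂(gegMeasure lam), 0 < x := by
  have h : gegMeasure lam ≪ volume.restrict (Ici (0 : ℝ)) := withDensity_absolutelyContinuous _ _
  apply h.ae_le
  rw [← Measure.restrict_congr_set (Ioi_ae_eq_Ici (μ := volume) (a := (0 : ℝ)))]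
  exact ae_restrict_mem measurableSet_Ioi

lemma gegMeasure_apply (lam : ℝ) {s : Set ℝ} (hs : MeasurableSet s) :
    gegMeasure lam s = ∫⁻ t in s ∩ Ioi 0, ENNReal.ofReal (Real.sinh t ^ (2 * lam)) := by
  rw [← setLIntegral_one, ← lintegral_indicator hs, lintegral_gegMeasure, ← setLIntegral_indicator hs]
  congr 1 with t
  by_cases ht : t ∈ s <;> simp [ht]

lemma gegMeasure_Icc_le {lam : ℝ} (hlam : 0 < lam) {a b : ℝ} (hab : a ≤ b) :
    gegMeasure lam (Icc a b) ≤ ENNReal.ofReal ((b - a) * Real.sinh b ^ (2 * lam)) := by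
  rw [gegMeasure_apply _ measurableSet_Icc]
  calc _ ≤ ∫⁻ t in Icc a b ∩ Ioi 0, ENNReal.ofReal (Real.sinh b ^ (2 * lam)) := by
        refine setLIntegral_mono' (measurableSet_Icc.inter measurableSet_Ioi) fun t ht => ?_
        apply ENNReal.ofReal_le_ofReal
        exact Real.rpow_le_rpow (Real.sinh_nonneg_iff.2 (le_of_lt ht.2))
          (Real.sinh_le_sinh.2 ht.1.2) (by linarith)
    _ ≤ ∫⁻ t in Icc a b, ENNReal.ofReal (Real.sinh b ^ (2 * lam)) :=
        lintegral_mono_set inter_subset_left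
    _ = _ := by
        rw [setLIntegral_const, Real.volume_Icc, mul_comm, ENNReal.ofReal_mul (by linarith)]

lemma le_gegMeasure_Ioo {lam : ℝ} (hlam : 0 < lam) {a b : ℝ} (ha : 0 ≤ a) (hab : a ≤ b) :
    ENNReal.ofReal ((b - a) * Real.sinh a ^ (2 * lam)) ≤ gegMeasure lam (Ioo 0 b) := by
  rw [gegMeasure_apply _ measurableSet_Ioo]
  calc ENNReal.ofReal ((b - a) * Real.sinh a ^ (2 * lam))
      = ∫⁻ t in Ioo a b, ENNReal.ofReal (Real.sinh a ^ (2 * lam)) := by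
        rw [setLIntegral_const, Real.volume_Ioo, mul_comm, ENNReal.ofReal_mul' (by linarith)]
    _ ≤ ∫⁻ t in Ioo a b, ENNReal.ofReal (Real.sinh t ^ (2 * lam)) := by
        refine setLIntegral_mono' measurableSet_Ioo fun t ht => ?_
        apply ENNReal.ofReal_le_ofReal
        exact Real.rpow_le_rpow (Real.sinh_nonneg_iff.2 ha)
          (Real.sinh_le_sinh.2 ht.1.le) (by linarith)
    _ ≤ _ := by
        refine lintegral_mono_set fun t ht => ?_
        have h0 : 0 < t := ha.trans_lt ht.1
        exact ⟨⟨h0, ht.2⟩, h0⟩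

lemma gegMeasure_Ioo_pos {lam : ℝ} (hlam : 0 < lam) {r : ℝ} (hr : 0 < r) :
    0 < gegMeasure lam (Ioo 0 r) := by
  refine lt_of_lt_of_le ?_ (le_gegMeasure_Ioo hlam (a := r / 2) (by linarith) (by linarith))
  have := Real.sinh_pos_iff.2 (show 0 < r / 2 by linarith)
  rw [ENNReal.ofReal_pos]
  have : 0 < r - r / 2 := by linarith
  positivity

lemma gegMeasure_Ioo_lt_top {lam : ℝ} (hlam : 0 < lam) {r : ℝ} (hr : 0 < r) :
    gegMeasure lam (Ioo 0 r) < ∞ :=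
  (measure_mono Ioo_subset_Icc_self).trans_lt
    ((gegMeasure_Icc_le hlam hr.le).trans_lt ENNReal.ofReal_lt_top)

lemma gegMeasure_Iic_le {lam : ℝ} (hlam : 0 < lam) (X : ℝ) :
    gegMeasure lam (Iic X) ≤ ENNReal.ofReal (Real.exp (2 * lam * X) / (2 * lam)) := by
  rw [gegMeasure_apply _ measurableSet_Iic]
  calc _ ≤ ∫⁻ t in Iic X ∩ Ioi 0, ENNReal.ofReal (Real.exp (2 * lam * t)) := by
        refine setLIntegral_mono' (measurableSet_Iic.inter measurableSet_Ioi) fun t ht => ?_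
        apply ENNReal.ofReal_le_ofReal
        have h0 : 0 < t := ht.2
        have : Real.sinh t ≤ Real.exp t := by
          rw [← Real.cosh_add_sinh]; linarith [Real.cosh_pos t]
        calc _ ≤ Real.exp t ^ (2 * lam) :=
              Real.rpow_le_rpow (Real.sinh_nonneg_iff.2 h0.le) this (by linarith)
          _ = _ := by rw [← Real.exp_mul, mul_comm]
    _ ≤ ∫⁻ t in Iic X, ENNReal.ofReal (Real.exp (2 * lam * t)) :=
        lintegral_mono_set inter_subset_left
    _ = _ := by
        rw [← ofReal_integral_eq_lintegral_ofReal (integrableOn_exp_mul_Iic (by linarith) X)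
          (ae_of_all _ fun t => (Real.exp_pos _).le), integral_exp_mul_Iic (by linarith)]

lemma gegMeasure_ball_zero (lam r : ℝ) :
    gegMeasure lam (ball 0 r) = gegMeasure lam (Ioo 0 r) := by
  have hm : MeasurableSet (ball 0 r) := measurableSet_Ioo.inter measurableSet_Ici
  rw [gegMeasure_apply _ hm, gegMeasure_apply _ measurableSet_Ioo]
  congr 2
  ext t
  simp only [ball, mem_inter_iff, mem_Ioo, mem_Ici, mem_Ioi]
  constructor
  · rintro ⟨⟨⟨-, h2⟩, -⟩, h4⟩; exact ⟨⟨h4, by linarith⟩, h4⟩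
  · rintro ⟨⟨h1, h2⟩, -⟩; exact ⟨⟨⟨by linarith, by linarith⟩, h1.le⟩, h1⟩

/-! ### The shift as an integral operator with a symmetric kernel -/

/-- The normalizing constant `Γ(λ + 1/2) / (Γ(1/2) Γ(λ))` of the generalized shift. -/
def shiftConst (lam : ℝ) : ℝ≥0∞ :=
  ENNReal.ofReal (Real.Gamma (lam + 1 / 2) / (Real.Gamma (1 / 2) * Real.Gamma lam))

/-- The density, with respect to `sinh^{2λ} z dz`, of the law of the third side `z` of a hyperbolic
triangle with sides `x`, `t` and a random angle `φ` between them, where `φ` has density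
proportional to `sin^{2λ-1} φ` on `(0, π)`. It vanishes unless `x`, `t`, `z` satisfy the strict
triangle inequalities, and it is symmetric in `x`, `t`, `z`. -/
def triangleKernel (lam x t z : ℝ) : ℝ≥0∞ :=
  if x < t + z ∧ t < x + z ∧ z < x + t then
    shiftConst lam * ENNReal.ofReal ((Real.sinh x * Real.sinh t * Real.sinh z) ^ (1 - 2 * lam) *
      (1 - Real.cosh x ^ 2 - Real.cosh t ^ 2 - Real.cosh z ^ 2 +
        2 * Real.cosh x * Real.cosh t * Real.cosh z) ^ (lam - 1))
  else 0

lemma triangleKernel_comm (lam x t z : ℝ) : triangleKernel lam x t z = triangleKernel lam x z t := by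
  unfold triangleKernel
  congr 1
  · apply propext
    constructor <;> rintro ⟨h1, h2, h3⟩ <;> refine ⟨?_, ?_, ?_⟩ <;> linarith
  · congr 3
    · congr 1; ring
    · congr 1; ring

lemma measurable_triangleKernel (lam : ℝ) :
    Measurable fun q : ℝ × ℝ × ℝ => triangleKernel lam q.1 q.2.1 q.2.2 := by
  unfold triangleKernel
  refine Measurable.ite ?_ (by fun_prop) measurable_const
  have h {u v : ℝ × ℝ × ℝ → ℝ} (hu : Measurable u) (hv : Measurable v) :
      MeasurableSet {q | u q < v q} := measurableSet_lt hu hv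
  exact (h (by fun_prop) (by fun_prop)).inter
    ((h (by fun_prop) (by fun_prop)).inter (h (by fun_prop) (by fun_prop)))

lemma image_cosh_Ioo {a b : ℝ} (ha : 0 ≤ a) (hab : a ≤ b) :
    Real.cosh '' Ioo a b = Ioo (Real.cosh a) (Real.cosh b) :=
  Real.continuous_cosh.continuousOn.image_Ioo_of_strictMonoOn hab
    (Real.cosh_strictMonoOn.mono fun _ hz => ha.trans hz.1)

lemma image_cosines_Ioo {x t : ℝ} (hx : 0 < x) (ht : 0 < t) :
    (fun φ => Real.cosh x * Real.cosh t - Real.sinh x * Real.sinh t * Real.cos φ) '' Ioo 0 Real.pi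
      = Ioo (Real.cosh (x - t)) (Real.cosh (x + t)) := by
  have hs : 0 < Real.sinh x * Real.sinh t :=
    mul_pos (Real.sinh_pos_iff.2 hx) (Real.sinh_pos_iff.2 ht)
  rw [ContinuousOn.image_Ioo_of_strictMonoOn Real.pi_pos.le (by fun_prop)]
  · simp [Real.cosh_sub, Real.cosh_add]
  · intro φ hφ ψ hψ h
    have := mul_lt_mul_of_pos_left (Real.strictAntiOn_cos hφ hψ h) hs
    simp only
    linarith

/-- The generalized shift as an integral operator. The point is that
`sin φ = √D / (sinh x sinh t)`, where `D` is the symmetric Gram determinant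
`1 - cosh² x - cosh² t - cosh² z + 2 cosh x cosh t cosh z`. -/
lemma shift_eq_lintegral_triangleKernel (lam : ℝ) {x t : ℝ} (hx : 0 < x) (ht : 0 < t)
    (F : ℝ → ℝ≥0∞) :
    shift lam t F x = ∫⁻ z, F (Real.cosh z) * triangleKernel lam x t z ∂(gegMeasure lam) := by
  have hsx := Real.sinh_pos_iff.2 hx
  have hst := Real.sinh_pos_iff.2 ht
  set s := Real.sinh x * Real.sinh t with hsdef
  have hs : 0 < s := mul_pos hsx hst
  set D : ℝ → ℝ := fun u => 1 - Real.cosh x ^ 2 - Real.cosh t ^ 2 - u ^ 2 +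
        2 * Real.cosh x * Real.cosh t * u with hD
  set H : ℝ → ℝ≥0∞ := fun u => F u * ENNReal.ofReal (s ^ (1 - 2 * lam) * D u ^ (lam - 1)) with hH
  -- both integrals are rewritten in the variable `u = cosh z`
  have e1 : ∫⁻ φ in Ioo 0 Real.pi,
      F (Real.cosh x * Real.cosh t - Real.sinh x * Real.sinh t * Real.cos φ) *
        ENNReal.ofReal (Real.sin φ ^ (2 * lam - 1)) =
      ∫⁻ u in Ioo (Real.cosh (x - t)) (Real.cosh (x + t)), H u := by
    rw [← image_cosines_Ioo hx ht, lintegral_image_eq_lintegral_abs_deriv_mul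
      (f' := fun φ => s * Real.sin φ) measurableSet_Ioo]
    · refine setLIntegral_congr_fun measurableSet_Ioo fun φ hφ => ?_
      have hsin := Real.sin_pos_of_mem_Ioo hφ
      have hDs : D (Real.cosh x * Real.cosh t - s * Real.cos φ) = s ^ 2 * Real.sin φ ^ 2 := by
        simp only [hD, hsdef, Real.sin_sq, Real.cosh_sq]; ring_nf
        simp only [Real.cosh_sq]; ring
      simp only [hH]
      rw [← hsdef, hDs]
      rw [mul_left_comm, ← ENNReal.ofReal_mul (abs_nonneg _)]
      congr 2
      rw [abs_of_pos (mul_pos hs hsin), Real.mul_rpow (sq_nonneg s) (sq_nonneg _),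
        ← Real.rpow_natCast, ← Real.rpow_natCast, ← Real.rpow_mul hs.le, ← Real.rpow_mul hsin.le]
      have a1 : s * s ^ (1 - 2 * lam) * s ^ (((2 : ℕ) : ℝ) * (lam - 1)) = 1 := by
        nth_rw 1 [← Real.rpow_one s]
        rw [← Real.rpow_add hs, ← Real.rpow_add hs, ← Real.rpow_zero s]
        congr 1; push_cast; ring
      have a2 : Real.sin φ * Real.sin φ ^ (((2 : ℕ) : ℝ) * (lam - 1)) =
          Real.sin φ ^ (2 * lam - 1) := by
        nth_rw 1 [← Real.rpow_one (Real.sin φ)]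
        rw [← Real.rpow_add hsin]
        congr 1; push_cast; ring
      rw [← a2]
      linear_combination (-(Real.sin φ * Real.sin φ ^ (((2 : ℕ) : ℝ) * (lam - 1)))) * a1
    · intro φ _
      have := ((Real.hasDerivAt_cos φ).const_mul s).const_sub (Real.cosh x * Real.cosh t)
      simpa using this.hasDerivWithinAt
    · intro φ hφ ψ hψ h
      have : Real.cos φ = Real.cos ψ := by
        have : s * Real.cos φ = s * Real.cos ψ := by
          simp only [hsdef] at *; linarith
        exact mul_left_cancel₀ hs.ne' this
      exact Real.injOn_cos (Ioo_subset_Icc_self hφ) (Ioo_subset_Icc_self hψ) this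
  have habs : |x - t| ≤ x + t := abs_le.2 ⟨by linarith, by linarith⟩
  have e2 : ∫⁻ z, F (Real.cosh z) * triangleKernel lam x t z ∂(gegMeasure lam) =
      shiftConst lam * ∫⁻ u in Ioo (Real.cosh (x - t)) (Real.cosh (x + t)), H u := by
    rw [← Real.cosh_abs (x - t), ← image_cosh_Ioo (abs_nonneg _) habs,
      lintegral_image_eq_lintegral_abs_deriv_mul (f' := Real.sinh) measurableSet_Ioo
      (fun z _ => (Real.hasDerivAt_cosh z).hasDerivWithinAt) ?_]
    · have hsub : Ioo |x - t| (x + t) ⊆ Ioi 0 := fun z hz => lt_of_le_of_lt (abs_nonneg _) hz.1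
      rw [lintegral_gegMeasure, ← lintegral_const_mul' _ _ (by simp [shiftConst]),
        ← lintegral_indicator measurableSet_Ioo, ← lintegral_indicator measurableSet_Ioi]
      congr 1 with z
      by_cases hz : z ∈ Ioo |x - t| (x + t)
      · have hz0 : 0 < z := hsub hz
        have hsz := Real.sinh_pos_iff.2 hz0
        have h1 := abs_lt.1 hz.1
        have htri : x < t + z ∧ t < x + z ∧ z < x + t := ⟨by linarith, by linarith, hz.2⟩
        rw [indicator_of_mem (show z ∈ Ioi 0 from hz0), indicator_of_mem hz, triangleKernel,
          if_pos htri]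
        simp only [hH, hD]
        rw [abs_of_pos hsz, ← hsdef, Real.mul_rpow hs.le hsz.le]
        have hz2 : Real.sinh z ^ (2 * lam) * Real.sinh z ^ (1 - 2 * lam) = Real.sinh z := by
          rw [← Real.rpow_add hsz]; simp
        have hz3 : ENNReal.ofReal (Real.sinh z) = ENNReal.ofReal (Real.sinh z ^ (2 * lam)) *
            ENNReal.ofReal (Real.sinh z ^ (1 - 2 * lam)) := by
          rw [← ENNReal.ofReal_mul (by positivity), hz2]
        rw [hz3, mul_assoc (s ^ _), mul_left_comm (s ^ _),
          ENNReal.ofReal_mul (p := Real.sinh z ^ (1 - 2 * lam)) (by positivity)]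
        ring
      · rw [indicator_of_notMem hz]
        by_cases hz0 : z ∈ Ioi 0
        · rw [indicator_of_mem hz0, triangleKernel, if_neg, mul_zero, mul_zero]
          rintro ⟨h1, h2, h3⟩
          exact hz ⟨abs_lt.2 ⟨by linarith, by linarith⟩, h3⟩
        · rw [indicator_of_notMem hz0]
    · refine Real.cosh_strictMonoOn.injOn.mono fun z hz => ?_
      exact ((abs_nonneg _).trans_lt hz.1).le
  rw [e2, shift, e1]
  rfl

/-- `ballShift lam r x z` is the shift by `z` of the indicator function of the ball of radius `r`
about the origin, evaluated at `x`; equivalently, the shift of a point mass at `z` averaged over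
that ball. -/
def ballShift (lam r x z : ℝ) : ℝ≥0∞ :=
  ∫⁻ t in Ioo 0 r, triangleKernel lam x t z ∂(gegMeasure lam)

lemma measurable_ballShift (lam r : ℝ) :
    Measurable fun q : ℝ × ℝ => ballShift lam r q.1 q.2 := by
  unfold ballShift
  refine Measurable.lintegral_prod_right' (f := fun q : (ℝ × ℝ) × ℝ =>
    triangleKernel lam q.1.1 q.2 q.1.2) ?_
  exact (measurable_triangleKernel lam).comp
    (f := fun q : (ℝ × ℝ) × ℝ => (q.1.1, q.2, q.1.2)) (by fun_prop)

/-- Integrating the shift over a ball is integrating against `ballShift`: the symmetry of the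
kernel moves the ball from the shift parameter to the integrand. -/
lemma setLIntegral_shift_eq (lam r : ℝ) {x : ℝ} (hx : 0 < x) (F : ℝ → ℝ≥0∞)
    (hF : AEMeasurable (fun z => F (Real.cosh z)) (gegMeasure lam)) :
    ∫⁻ t in Ioo 0 r, shift lam t F x ∂(gegMeasure lam) =
      ∫⁻ z, F (Real.cosh z) * ballShift lam r x z ∂(gegMeasure lam) := by
  calc _ = ∫⁻ t in Ioo 0 r, ∫⁻ z, F (Real.cosh z) * triangleKernel lam x t z ∂(gegMeasure lam)
        ∂(gegMeasure lam) :=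
      setLIntegral_congr_fun measurableSet_Ioo fun t ht =>
        shift_eq_lintegral_triangleKernel lam hx ht.1 F
    _ = ∫⁻ z, ∫⁻ t in Ioo 0 r, F (Real.cosh z) * triangleKernel lam x t z ∂(gegMeasure lam)
        ∂(gegMeasure lam) := by
      apply lintegral_lintegral_swap
      refine AEMeasurable.mul hF.comp_snd ?_
      exact ((measurable_triangleKernel lam).comp
        (measurable_const.prodMk (measurable_fst.prodMk measurable_snd))).aemeasurable
    _ = _ := by
      refine lintegral_congr fun z => ?_
      rw [lintegral_const_mul]
      · rfl
      · exact (measurable_triangleKernel lam).comp (f := fun t : ℝ => (x, t, z)) (by fun_prop)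

lemma ballShift_eq_shift (lam : ℝ) {r x z : ℝ} (hr : 0 < r) (hx : 0 < x) (hz : 0 < z) :
    ballShift lam r x z = shift lam z ((Iio (Real.cosh r)).indicator 1) x := by
  rw [shift_eq_lintegral_triangleKernel lam hx hz, ballShift, ← lintegral_indicator
    measurableSet_Ioo]
  refine lintegral_congr_ae ?_
  filter_upwards [ae_pos lam] with t ht
  have : Real.cosh t < Real.cosh r ↔ t < r := by
    rw [Real.cosh_lt_cosh, abs_of_pos ht, abs_of_pos hr]
  rw [triangleKernel_comm]
  by_cases h : t < r
  · rw [indicator_of_mem (show t ∈ Ioo 0 r from ⟨ht, h⟩),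
      indicator_of_mem (show Real.cosh t ∈ Iio (Real.cosh r) from this.2 h)]
    simp
  · rw [indicator_of_notMem (fun h' : t ∈ Ioo 0 r => h h'.2),
      indicator_of_notMem (fun h' : Real.cosh t ∈ Iio (Real.cosh r) => h (this.1 h'))]
    simp

/-! ### Kernel estimates -/

lemma Gamma_quotient_pos {lam : ℝ} (hlam : 0 < lam) :
    0 < Real.Gamma (lam + 1 / 2) / (Real.Gamma (1 / 2) * Real.Gamma lam) := by
  have := Real.Gamma_pos_of_pos hlam
  have := Real.Gamma_pos_of_pos (show (0 : ℝ) < lam + 1 / 2 by linarith)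
  have := Real.Gamma_pos_of_pos (show (0 : ℝ) < 1 / 2 by norm_num)
  positivity

/-- For exponents of either sign, `sin φ` may be replaced by `φ` up to a constant on `(0, π/2)`. -/
lemma exists_sin_rpow_le (e : ℝ) :
    ∃ C : ℝ, 0 < C ∧ ∀ φ ∈ Ioo 0 (Real.pi / 2), Real.sin φ ^ e ≤ C * φ ^ e := by
  have hpi := Real.pi_pos
  refine ⟨1 + (2 / Real.pi) ^ e, by positivity, fun φ hφ => ?_⟩
  have h0 := hφ.1
  have hsin : 0 < Real.sin φ := Real.sin_pos_of_pos_of_lt_pi h0 (by linarith [hφ.2])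
  have hpos : 0 ≤ (2 / Real.pi) ^ e * φ ^ e := by positivity
  have hpos' : 0 ≤ φ ^ e := by positivity
  rw [add_mul, one_mul]
  rcases le_total 0 e with he | he
  · have := Real.rpow_le_rpow hsin.le (Real.sin_le h0.le) he
    linarith
  · have := Real.rpow_le_rpow_of_nonpos (by positivity) (Real.mul_le_sin h0.le hφ.2.le) he
    rw [Real.mul_rpow (by positivity) h0.le] at this
    linarith

lemma intervalIntegrable_sin_rpow {lam : ℝ} (hlam : 0 < lam) :
    IntervalIntegrable (fun φ => Real.sin φ ^ (2 * lam - 1)) volume 0 Real.pi := by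
  have hpi := Real.pi_pos
  have h1 : IntervalIntegrable (fun φ => Real.sin φ ^ (2 * lam - 1)) volume 0 (Real.pi / 2) := by
    obtain ⟨C, hC, h⟩ := exists_sin_rpow_le (2 * lam - 1)
    have hi : IntervalIntegrable (fun φ : ℝ => C * φ ^ (2 * lam - 1)) volume 0 (Real.pi / 2) :=
      (intervalIntegral.intervalIntegrable_rpow' (by linarith)).const_mul C
    rw [intervalIntegrable_iff_integrableOn_Ioo_of_le (by positivity)] at hi ⊢
    refine Integrable.mono' hi (Measurable.aestronglyMeasurable (by fun_prop)) ?_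
    filter_upwards [ae_restrict_mem measurableSet_Ioo] with φ hφ
    have hsin : 0 < Real.sin φ := Real.sin_pos_of_pos_of_lt_pi hφ.1 (by linarith [hφ.2])
    rw [Real.norm_of_nonneg (by positivity)]
    exact h φ hφ
  have h2 := h1.comp_sub_left Real.pi
  simp only [Real.sin_pi_sub, sub_zero, show Real.pi - Real.pi / 2 = Real.pi / 2 by ring] at h2
  exact h1.trans h2.symm

lemma exists_lintegral_sin_rpow_le {lam : ℝ} (hlam : 0 < lam) :
    ∃ C : ℝ, 0 < C ∧
      (∫⁻ φ in Ioo 0 Real.pi, ENNReal.ofReal (Real.sin φ ^ (2 * lam - 1)) ≤ ENNReal.ofReal C) ∧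
      ∀ θ : ℝ, 0 ≤ θ → θ ≤ Real.pi / 2 →
        ∫⁻ φ in Ioo 0 θ, ENNReal.ofReal (Real.sin φ ^ (2 * lam - 1)) ≤
          ENNReal.ofReal (C * θ ^ (2 * lam)) := by
  have hpi := Real.pi_pos
  obtain ⟨C, hC, h⟩ := exists_sin_rpow_le (2 * lam - 1)
  have hint := intervalIntegrable_sin_rpow hlam
  rw [intervalIntegrable_iff_integrableOn_Ioo_of_le hpi.le] at hint
  set B := ∫ φ in Ioo 0 Real.pi, Real.sin φ ^ (2 * lam - 1)
  have hB : 0 ≤ B := setIntegral_nonneg measurableSet_Ioo fun φ hφ =>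
    Real.rpow_nonneg (Real.sin_nonneg_of_mem_Icc (Ioo_subset_Icc_self hφ)) _
  refine ⟨B + C / (2 * lam), by positivity, ?_, fun θ h0 h1 => ?_⟩
  · rw [← ofReal_integral_eq_lintegral_ofReal hint]
    · exact ENNReal.ofReal_le_ofReal (le_add_of_nonneg_right (by positivity))
    · filter_upwards [ae_restrict_mem measurableSet_Ioo] with φ hφ
      exact Real.rpow_nonneg (Real.sin_nonneg_of_mem_Icc (Ioo_subset_Icc_self hφ)) _
  · calc _ ≤ ∫⁻ φ in Ioo 0 θ, ENNReal.ofReal (C * φ ^ (2 * lam - 1)) :=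
          setLIntegral_mono' measurableSet_Ioo fun φ hφ =>
            ENNReal.ofReal_le_ofReal (h φ ⟨hφ.1, hφ.2.trans_le h1⟩)
      _ = ENNReal.ofReal (∫ φ in Ioo 0 θ, C * φ ^ (2 * lam - 1)) := by
          rw [ofReal_integral_eq_lintegral_ofReal]
          · have hi : IntervalIntegrable (fun φ : ℝ => C * φ ^ (2 * lam - 1)) volume 0 θ :=
              (intervalIntegral.intervalIntegrable_rpow' (by linarith)).const_mul C
            rwa [intervalIntegrable_iff_integrableOn_Ioo_of_le h0] at hi
          · filter_upwards [ae_restrict_mem measurableSet_Ioo] with φ hφ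
            have := hφ.1
            simp only [Pi.zero_apply]
            positivity
      _ ≤ _ := by
          apply ENNReal.ofReal_le_ofReal
          rw [← integral_Ioc_eq_integral_Ioo, ← intervalIntegral.integral_of_le h0,
            intervalIntegral.integral_const_mul, integral_rpow (Or.inl (by linarith)),
            sub_add_cancel, Real.zero_rpow (by positivity), sub_zero, add_mul]
          have : C * (θ ^ (2 * lam) / (2 * lam)) = C / (2 * lam) * θ ^ (2 * lam) := by ring
          rw [this]
          simp only [le_add_iff_nonneg_left]
          positivity

lemma ballShift_eq_zero (lam : ℝ) {r x z : ℝ} (h : r ≤ |x - z|) : ballShift lam r x z = 0 := by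
  rw [ballShift, setLIntegral_congr_fun (g := 0) measurableSet_Ioo]
  · simp
  · intro t ht
    simp only [triangleKernel, Pi.zero_apply]
    rw [if_neg]
    rintro ⟨h1, -, h3⟩
    have : |x - z| < t := abs_lt.2 ⟨by linarith, by linarith⟩
    linarith [ht.2]

/-- The average `ballShift lam r x z` is at most a constant times the `λ`-th power of
`q = (cosh r - cosh (x - z)) / (sinh x sinh z)`: the angles `φ` that count are those with
`1 - cos φ < q`, hence they are `O(√q)`. -/
lemma exists_ballShift_le {lam : ℝ} (hlam : 0 < lam) :
    ∃ C : ℝ, 0 < C ∧ ∀ r x z : ℝ, 0 < r → 0 < x → 0 < z → ∀ q : ℝ, 0 < q →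
      (1 ≤ q ∨ Real.cosh r - Real.cosh (x - z) ≤ q * (Real.sinh x * Real.sinh z)) →
      ballShift lam r x z ≤ ENNReal.ofReal (C * q ^ lam) := by
  have hpi := Real.pi_pos
  obtain ⟨C, hC, htot, hloc⟩ := exists_lintegral_sin_rpow_le hlam
  set c := Real.Gamma (lam + 1 / 2) / (Real.Gamma (1 / 2) * Real.Gamma lam) with hc
  have hc0 : 0 < c := Gamma_quotient_pos hlam
  set K := 2 ^ lam + (Real.pi ^ 2 / 2) ^ lam with hK
  have hK0 : 0 < K := by positivity
  refine ⟨c * (C * K), by positivity, fun r x z hr hx hz q hq hcond => ?_⟩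
  have hs : 0 < Real.sinh x * Real.sinh z :=
    mul_pos (Real.sinh_pos_iff.2 hx) (Real.sinh_pos_iff.2 hz)
  rw [ballShift_eq_shift lam hr hx hz, shift, ← hc, mul_assoc, ENNReal.ofReal_mul hc0.le]
  refine mul_le_mul_right ?_ _
  have hKq : K * q ^ lam = (2 * q) ^ lam + (Real.pi ^ 2 / 2 * q) ^ lam := by
    rw [hK, Real.mul_rpow (by positivity) hq.le, Real.mul_rpow (by positivity) hq.le]; ring
  by_cases hq2 : 1 / 2 ≤ q
  · calc _ ≤ ∫⁻ φ in Ioo 0 Real.pi, ENNReal.ofReal (Real.sin φ ^ (2 * lam - 1)) := by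
          refine lintegral_mono fun φ => ?_
          refine mul_le_of_le_one_left' ?_
          exact indicator_le_self' (fun _ _ => zero_le_one) _
      _ ≤ _ := htot
      _ ≤ _ := by
          apply ENNReal.ofReal_le_ofReal
          rw [mul_assoc, hKq]
          have h1 : 1 ≤ (2 * q) ^ lam := Real.one_le_rpow (by linarith) hlam.le
          have h2 : 0 ≤ (Real.pi ^ 2 / 2 * q) ^ lam := by positivity
          nlinarith
  · push Not at hq2
    have hcond' : Real.cosh r - Real.cosh (x - z) ≤ q * (Real.sinh x * Real.sinh z) := by
      rcases hcond with h | h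
      · linarith
      · exact h
    set θ := Real.pi * Real.sqrt (q / 2) with hθ
    have hsq : Real.sqrt (q / 2) ^ 2 = q / 2 := Real.sq_sqrt (by positivity)
    have hsq0 : 0 ≤ Real.sqrt (q / 2) := Real.sqrt_nonneg _
    have hθ2 : θ ≤ Real.pi / 2 := by
      have : Real.sqrt (q / 2) ≤ 1 / 2 := by nlinarith
      nlinarith
    have hθlam : θ ^ (2 * lam) = (Real.pi ^ 2 / 2 * q) ^ lam := by
      rw [Real.rpow_mul (by positivity), Real.rpow_two, hθ, mul_pow, hsq]
      congr 1; ring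
    calc _ ≤ ∫⁻ φ in Ioo 0 θ, ENNReal.ofReal (Real.sin φ ^ (2 * lam - 1)) := by
          rw [← lintegral_indicator measurableSet_Ioo, ← lintegral_indicator measurableSet_Ioo]
          refine lintegral_mono fun φ => ?_
          by_cases hφ : φ ∈ Ioo 0 Real.pi
          swap
          · simp only [indicator_of_notMem hφ]; exact zero_le
          rw [indicator_of_mem hφ]
          by_cases hu : Real.cosh x * Real.cosh z - Real.sinh x * Real.sinh z * Real.cos φ ∈
              Iio (Real.cosh r)
          · have h1 : 1 - Real.cos φ < q := by
              have : Real.sinh x * Real.sinh z * (1 - Real.cos φ) <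
                  Real.sinh x * Real.sinh z * q := by
                rw [mem_Iio] at hu
                rw [Real.cosh_sub] at hcond'
                linarith
              exact lt_of_mul_lt_mul_left this hs.le
            have h2 := Real.cos_le_one_sub_mul_cos_sq
              (abs_le.2 ⟨by linarith [hφ.1], hφ.2.le⟩ : |φ| ≤ Real.pi)
            have h3 : φ ^ 2 < θ ^ 2 := by
              rw [hθ, mul_pow, hsq]
              have : 2 / Real.pi ^ 2 * φ ^ 2 < q := by linarith
              rw [div_mul_eq_mul_div, div_lt_iff₀ (by positivity)] at this
              linarith
            have h4 : φ ∈ Ioo 0 θ := ⟨hφ.1, lt_of_pow_lt_pow_left₀ 2 (by positivity) h3⟩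
            rw [indicator_of_mem h4, indicator_of_mem hu]
            simp
          · rw [indicator_of_notMem hu, zero_mul]; exact zero_le
      _ ≤ _ := hloc θ (by positivity) hθ2
      _ ≤ _ := by
          apply ENNReal.ofReal_le_ofReal
          rw [mul_assoc, hKq, hθlam]
          have h2 : 0 ≤ (2 * q) ^ lam := by positivity
          nlinarith

lemma cosh_sub_one_le_sq {r : ℝ} (h0 : 0 ≤ r) (h1 : r ≤ 1) : Real.cosh r - 1 ≤ r ^ 2 := by
  have h2 : |r ^ 2 / 2| ≤ 1 := by rw [abs_le]; constructor <;> nlinarith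
  have h := (abs_le.1 (Real.abs_exp_sub_one_le h2)).2
  rw [abs_of_nonneg (by positivity)] at h
  linarith [Real.cosh_le_exp_half_sq r]

/-- For `r ≤ 1` the kernel of the averaging operator is dominated by the kernel of the average over
the interval `[x - r, x + r]`. -/
lemma exists_ballShift_mul_gegMeasure_Icc_le {lam : ℝ} (hlam : 0 < lam) :
    ∃ C : ℝ, 0 < C ∧ ∀ r x z : ℝ, 0 < r → r ≤ 1 → 0 < x → 0 < z → |x - z| < r →
      ballShift lam r x z * gegMeasure lam (Icc (x - r) (x + r)) ≤
        ENNReal.ofReal C * gegMeasure lam (Ioo 0 r) := by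
  obtain ⟨C, hC, hW⟩ := exists_ballShift_le hlam
  refine ⟨C * 1156 ^ lam * 2 ^ (2 * lam) * 4, by positivity, fun r x z hr hr1 hx hz hxz => ?_⟩
  have hxz' := abs_lt.1 hxz
  set S := Real.sinh (x + r) with hS
  have hS0 : 0 < S := Real.sinh_pos_iff.2 (by linarith)
  have hsx := Real.sinh_pos_iff.2 hx
  have hsz := Real.sinh_pos_iff.2 hz
  have hsr := Real.sinh_pos_iff.2 hr
  have hch := cosh_sub_one_le_sq hr.le hr1
  have hch1 := Real.one_le_cosh r
  have hch2 : Real.cosh r ≤ 2 := by nlinarith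
  have hsr2 : Real.sinh r ≤ 2 * r := by
    have := Real.cosh_sq r
    have : Real.sinh r ^ 2 ≤ (2 * r) ^ 2 := by nlinarith
    exact le_of_sq_le_sq this (by positivity)
  have hc2r : Real.cosh (2 * r) ≤ 9 := by
    rw [Real.cosh_two_mul, Real.sinh_sq]; nlinarith
  have hs2r : Real.sinh (2 * r) ≤ 8 * r := by
    rw [Real.sinh_two_mul]; nlinarith
  -- this `q` dominates the ratio in `exists_ballShift_le`, or is at least `1` when `x ≤ 2 * r`
  have hq : 1 ≤ 1156 * r ^ 2 / S ^ 2 ∨ Real.cosh r - Real.cosh (x - z) ≤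
      1156 * r ^ 2 / S ^ 2 * (Real.sinh x * Real.sinh z) := by
    rcases le_total x (2 * r) with h | h
    · left
      have : S ≤ 34 * r := by
        calc S ≤ Real.sinh (2 * r + r) := Real.sinh_le_sinh.2 (by linarith)
          _ ≤ _ := by rw [Real.sinh_add]; nlinarith [Real.cosh_pos (2 * r)]
      rw [le_div_iff₀ (by positivity)]
      nlinarith
    · right
      have k1 : S ≤ 4 * Real.sinh x := by
        have : 0 ≤ Real.sinh (x - r) := Real.sinh_nonneg_iff.2 (by linarith)
        rw [Real.sinh_sub] at this
        rw [hS, Real.sinh_add]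
        nlinarith
      have k2 : S ≤ 17 * Real.sinh z := by
        have : 0 ≤ Real.sinh (z - r) := Real.sinh_nonneg_iff.2 (by linarith)
        rw [Real.sinh_sub] at this
        calc S ≤ Real.sinh (z + 2 * r) := Real.sinh_le_sinh.2 (by linarith)
          _ = Real.sinh z * Real.cosh (2 * r) +
                2 * Real.cosh r * (Real.cosh z * Real.sinh r) := by
              rw [Real.sinh_add, Real.sinh_two_mul]; ring
          _ ≤ Real.sinh z * 9 + 2 * Real.cosh r * (Real.sinh z * Real.cosh r) := by
              exact add_le_add (mul_le_mul_of_nonneg_left hc2r hsz.le)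
                (mul_le_mul_of_nonneg_left (by linarith) (by positivity))
          _ = Real.sinh z * 9 + 2 * Real.sinh z * Real.cosh r ^ 2 := by ring
          _ ≤ Real.sinh z * 9 + 2 * Real.sinh z * 2 ^ 2 := by gcongr
          _ = _ := by ring
      have k3 : S ^ 2 ≤ 68 * (Real.sinh x * Real.sinh z) := by
        nlinarith [mul_le_mul k1 k2 hS0.le (by positivity)]
      have k4 := Real.one_le_cosh (x - z)
      rw [div_mul_eq_mul_div, le_div_iff₀ (by positivity)]
      have : (Real.cosh r - Real.cosh (x - z)) * S ^ 2 ≤ r ^ 2 * S ^ 2 := by gcongr; linarith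
      nlinarith [mul_le_mul_of_nonneg_left k3 (sq_nonneg r), mul_pos hsx hsz,
        mul_nonneg (sq_nonneg r) (mul_pos hsx hsz).le]
  calc _ ≤ ENNReal.ofReal (C * (1156 * r ^ 2 / S ^ 2) ^ lam) *
        ENNReal.ofReal ((x + r - (x - r)) * S ^ (2 * lam)) :=
        mul_le_mul' (hW r x z hr hx hz _ (by positivity) hq)
          (gegMeasure_Icc_le hlam (by linarith))
    _ = ENNReal.ofReal (C * 1156 ^ lam * 2 ^ (2 * lam) * 4 *
          ((r - r / 2) * (r / 2) ^ (2 * lam))) := by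
        rw [← ENNReal.ofReal_mul (by positivity)]
        congr 1
        rw [Real.div_rpow (by positivity) (by positivity), Real.mul_rpow (by positivity)
          (by positivity), ← Real.rpow_natCast, ← Real.rpow_natCast, ← Real.rpow_mul hr.le,
          ← Real.rpow_mul hS0.le, Real.div_rpow hr.le (by positivity)]
        push_cast
        have : S ^ (2 * lam) ≠ 0 := by positivity
        have : (2 : ℝ) ^ (2 * lam) ≠ 0 := by positivity
        field_simp
        ring
    _ ≤ _ := by
        rw [ENNReal.ofReal_mul (by positivity)]
        refine mul_le_mul_right ?_ _
        refine le_trans (ENNReal.ofReal_le_ofReal ?_)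
          (le_gegMeasure_Ioo hlam (a := r / 2) (b := r) (by linarith) (by linarith))
        have : r / 2 ≤ Real.sinh (r / 2) := Real.self_le_sinh_iff.2 (by linarith)
        have h0 : 0 ≤ r - r / 2 := by linarith
        gcongr

lemma exp_div_four_le_sinh {u : ℝ} (hu : 1 / 2 ≤ u) : Real.exp u / 4 ≤ Real.sinh u := by
  rw [Real.sinh_eq]
  have h1 : Real.exp (-u) * 2 ≤ Real.exp u := by
    have h2 : (2 : ℝ) ≤ Real.exp (2 * u) := by
      have := Real.add_one_le_exp (2 * u); linarith
    calc _ ≤ Real.exp (-u) * Real.exp (2 * u) := by gcongr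
      _ = _ := by rw [← Real.exp_add]; congr 1; ring
  linarith

/-- For `r ≥ 1` the kernel of the averaging operator is at most a constant times `e^{-2λx}`,
uniformly in `r` and `z`. -/
lemma exists_ballShift_mul_exp_le {lam : ℝ} (hlam : 0 < lam) :
    ∃ C : ℝ, 0 < C ∧ ∀ r x z : ℝ, 1 ≤ r → 0 < x → 0 < z →
      ballShift lam r x z * ENNReal.ofReal (Real.exp (2 * lam * x)) ≤
        ENNReal.ofReal C * gegMeasure lam (Ioo 0 r) := by
  obtain ⟨C, hC, hW⟩ := exists_ballShift_le hlam
  refine ⟨C * 16 ^ lam * 8 ^ (2 * lam) * 2, by positivity, fun r x z hr hx hz => ?_⟩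
  rcases le_or_gt r |x - z| with hxz | hxz
  · rw [ballShift_eq_zero lam hxz, zero_mul]; exact zero_le
  have hxz' := abs_lt.1 hxz
  have hq : 1 ≤ 16 * Real.exp (2 * (r - x)) ∨ Real.cosh r - Real.cosh (x - z) ≤
      16 * Real.exp (2 * (r - x)) * (Real.sinh x * Real.sinh z) := by
    rcases le_total x (r + 1) with h | h
    · left
      have h1 : Real.exp (-2) ≤ Real.exp (2 * (r - x)) := Real.exp_le_exp.2 (by linarith)
      have h2 : Real.exp 2 ≤ 16 := by
        have : Real.exp 2 = Real.exp 1 * Real.exp 1 := by rw [← Real.exp_add]; norm_num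
        nlinarith [Real.exp_one_lt_d9, Real.exp_pos 1]
      have h3 : Real.exp (-2) * Real.exp 2 = 1 := by rw [← Real.exp_add]; norm_num
      nlinarith [Real.exp_pos (-2)]
    · right
      have s1 := exp_div_four_le_sinh (show 1 / 2 ≤ x by linarith)
      have s2 := exp_div_four_le_sinh (show 1 / 2 ≤ z by linarith)
      have c1 : Real.cosh r ≤ Real.exp r := by
        rw [← Real.cosh_add_sinh]
        linarith [Real.sinh_nonneg_iff.2 (show 0 ≤ r by linarith)]
      calc _ ≤ Real.exp r := by linarith [Real.cosh_pos (x - z)]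
        _ ≤ Real.exp (2 * (r - x) + (x + z)) := Real.exp_le_exp.2 (by linarith)
        _ = 16 * Real.exp (2 * (r - x)) * (Real.exp x / 4 * (Real.exp z / 4)) := by
            rw [Real.exp_add, Real.exp_add]; ring
        _ ≤ _ := by gcongr
  calc _ ≤ ENNReal.ofReal (C * (16 * Real.exp (2 * (r - x))) ^ lam) *
        ENNReal.ofReal (Real.exp (2 * lam * x)) :=
        mul_le_mul_left (hW r x z (by linarith) hx hz _ (by positivity) hq) _
    _ = ENNReal.ofReal (C * 16 ^ lam * 8 ^ (2 * lam) * 2 *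
          ((r - (r - 1 / 2)) * (Real.exp r / 8) ^ (2 * lam))) := by
        rw [← ENNReal.ofReal_mul (by positivity)]
        congr 1
        rw [Real.div_rpow (by positivity) (by positivity), Real.mul_rpow (by positivity)
          (by positivity), ← Real.exp_mul, ← Real.exp_mul]
        have : (8 : ℝ) ^ (2 * lam) ≠ 0 := by positivity
        have h : Real.exp (r * (2 * lam)) =
            Real.exp (2 * (r - x) * lam) * Real.exp (2 * lam * x) := by
          rw [← Real.exp_add]; congr 1; ring
        rw [h]
        field_simp
        ring
    _ ≤ _ := by
        rw [ENNReal.ofReal_mul (by positivity)]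
        refine mul_le_mul_right ?_ _
        refine le_trans (ENNReal.ofReal_le_ofReal ?_)
          (le_gegMeasure_Ioo hlam (a := r - 1 / 2) (b := r) (by linarith) (by linarith))
        have : Real.exp r / 8 ≤ Real.sinh (r - 1 / 2) := by
          refine le_trans ?_ (exp_div_four_le_sinh (by linarith))
          have h1 : Real.exp (1 / 2) ≤ 2 := by
            have : Real.exp (1 / 2) ^ 2 = Real.exp 1 := by
              rw [← Real.exp_nat_mul]; norm_num
            nlinarith [Real.exp_one_lt_d9, Real.exp_pos (1 / 2)]
          have h2 : Real.exp r = Real.exp (r - 1 / 2) * Real.exp (1 / 2) := by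
            rw [← Real.exp_add]; congr 1; ring
          nlinarith [Real.exp_pos (r - 1 / 2)]
        have h0 : 0 ≤ r - (r - 1 / 2) := by linarith
        gcongr

/-! ### The weak type estimate -/

/-- Weak type estimate for the centered maximal function over intervals of radius at most one, for
an arbitrary measure on the line; it follows from the Besicovitch covering theorem. -/
lemma exists_measure_le_of_forall_exists_closedBall :
    ∃ N : ℕ, ∀ (μ : Measure ℝ) (G : ℝ → ℝ≥0∞) (κ : ℝ≥0∞) (E : Set ℝ),
      (∀ x ∈ E, ∃ r : ℝ, 0 < r ∧ r ≤ 1 ∧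
        κ * μ (Metric.closedBall x r) ≤ ∫⁻ t in Metric.closedBall x r, G t ∂μ) →
      κ * μ E ≤ N * ∫⁻ t, G t ∂μ := by
  obtain ⟨N, τ, hτ, hN⟩ := HasBesicovitchCovering.no_satelliteConfig (α := ℝ)
  refine ⟨N, fun μ G κ E hE => ?_⟩
  choose! ρ hρ0 hρ1 hρ using hE
  let q : Besicovitch.BallPackage E ℝ :=
    { c := fun x => x
      r := fun x => ρ x
      rpos := fun x => hρ0 x x.2
      r_bound := 1
      r_le := fun x => hρ1 x x.2 }
  obtain ⟨s, hdis, hcov⟩ := Besicovitch.exist_disjoint_covering_families hτ hN q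
  have hcount (i : Fin N) : (s i).Countable := by
    refine (hdis i).countable_of_nonempty_interior fun j _ => ?_
    exact ⟨q.c j, Metric.ball_subset_interior_closedBall (Metric.mem_ball_self (q.rpos j))⟩
  have hfam (i : Fin N) : κ * μ (⋃ j ∈ s i, Metric.closedBall (q.c j) (q.r j)) ≤
      ∫⁻ t, G t ∂μ := by
    calc _ ≤ κ * ∑' j : s i, μ (Metric.closedBall (q.c j) (q.r j)) :=
          mul_le_mul_right (measure_biUnion_le _ (hcount i) _) _
      _ = ∑' j : s i, κ * μ (Metric.closedBall (q.c j) (q.r j)) := ENNReal.tsum_mul_left.symm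
      _ ≤ ∑' j : s i, ∫⁻ t in Metric.closedBall (q.c j) (q.r j), G t ∂μ :=
          ENNReal.tsum_le_tsum fun j => hρ j.1 j.1.2
      _ = ∫⁻ t in ⋃ j ∈ s i, Metric.closedBall (q.c j) (q.r j), G t ∂μ :=
          (lintegral_biUnion (hcount i) (fun _ _ => Metric.isClosed_closedBall.measurableSet)
            (hdis i) _).symm
      _ ≤ _ := setLIntegral_le_lintegral _ _
  have hsub : E ⊆ ⋃ i : Fin N, ⋃ j ∈ s i, Metric.closedBall (q.c j) (q.r j) := by
    intro x hx
    have := hcov ⟨⟨x, hx⟩, rfl⟩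
    simp only [mem_iUnion] at this ⊢
    obtain ⟨i, j, hj, h⟩ := this
    exact ⟨i, j, hj, Metric.ball_subset_closedBall h⟩
  calc κ * μ E ≤ κ * ∑ i : Fin N, μ (⋃ j ∈ s i, Metric.closedBall (q.c j) (q.r j)) := by
        gcongr
        exact (measure_mono hsub).trans (measure_iUnion_fintype_le _ _)
    _ = ∑ i : Fin N, κ * μ (⋃ j ∈ s i, Metric.closedBall (q.c j) (q.r j)) := Finset.mul_sum _ _ _
    _ ≤ ∑ _i : Fin N, ∫⁻ t, G t ∂μ := Finset.sum_le_sum fun i _ => hfam i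
    _ = _ := by simp

/-- The supremum over radii can be restricted to rational ones, since the integral over `(0, r)` is
left-continuous in `r`; each average is measurable in its integral kernel form. -/
lemma aemeasurable_maximalG (lam : ℝ) (f : ℝ → ℂ)
    (hf : AEMeasurable (fun t => ‖f (Real.cosh t)‖ₑ) (gegMeasure lam)) :
    AEMeasurable (maximalG lam f) (gegMeasure lam) := by
  have hrat (x : ℝ) : maximalG lam f x = ⨆ (q : ℚ) (_ : (0 : ℝ) < q),
      (gegMeasure lam (ball 0 q))⁻¹ *
        ∫⁻ t in Ioo 0 (q : ℝ), shift lam t (fun z => ‖f z‖ₑ) x ∂(gegMeasure lam) := by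
    refine le_antisymm (iSup₂_le fun r hr => ?_) (iSup₂_le fun q hq =>
      le_iSup₂_of_le (q : ℝ) hq le_rfl)
    have hU : Ioo 0 r = ⋃ q : {q : ℚ // 0 < (q : ℝ) ∧ (q : ℝ) < r}, Ioo 0 ((q : ℚ) : ℝ) := by
      ext t
      simp only [mem_iUnion, mem_Ioo]
      constructor
      · rintro ⟨h1, h2⟩
        obtain ⟨q, hq1, hq2⟩ := exists_rat_btwn h2
        exact ⟨⟨q, h1.trans hq1, hq2⟩, h1, hq1⟩
      · rintro ⟨q, h1, h2⟩
        exact ⟨h1, h2.trans q.2.2⟩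
    rw [hU, setLIntegral_iUnion_of_directed, ENNReal.mul_iSup]
    · refine iSup_le fun q => ?_
      refine le_iSup₂_of_le (q : ℚ) q.2.1 ?_
      gcongr
      simp only [ball]
      gcongr
      · linarith [q.2.2]
      · linarith [q.2.2]
    · refine Monotone.directed_le fun q q' h => ?_
      refine Ioo_subset_Ioo_right ?_
      exact_mod_cast h
  have hpos : maximalG lam f =ᵐ[gegMeasure lam] fun x => ⨆ (q : ℚ) (_ : (0 : ℝ) < q),
      (gegMeasure lam (ball 0 q))⁻¹ *
        ∫⁻ z, ‖f (Real.cosh z)‖ₑ * ballShift lam q x z ∂(gegMeasure lam) := by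
    filter_upwards [ae_pos lam] with x hx
    simp_rw [hrat, setLIntegral_shift_eq lam _ hx (fun z => ‖f z‖ₑ) hf]
  refine AEMeasurable.congr ?_ hpos.symm
  refine AEMeasurable.iSup fun q => AEMeasurable.iSup fun _ => AEMeasurable.const_mul ?_ _
  exact AEMeasurable.lintegral_prod_right'
    (f := fun p : ℝ × ℝ => ‖f (Real.cosh p.2)‖ₑ * ballShift lam q p.1 p.2)
    (hf.comp_snd.mul (measurable_ballShift lam q).aemeasurable)

/-- The weak type `(1, 1)` estimate. Radii at most one are controlled by averages over intervals
and hence by the Besicovitch covering theorem. Averages over larger balls are at most a constant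
times `e^{-2λx} ‖f‖₁`, and `e^{-2λx}` is in weak `L¹` for `sinh^{2λ} x dx`. -/
lemma exists_weak_type_maximalG {lam : ℝ} (hlam : 0 < lam) :
    ∃ C : ℝ, 0 < C ∧ ∀ f : ℝ → ℂ,
      AEMeasurable (fun t => ‖f (Real.cosh t)‖ₑ) (gegMeasure lam) → ∀ α : ℝ, 0 < α →
      gegMeasure lam {x | ENNReal.ofReal α < maximalG lam f x} ≤
        ENNReal.ofReal (C / α) * ∫⁻ t, ‖f (Real.cosh t)‖ₑ ∂(gegMeasure lam) := by
  obtain ⟨C₁, hC₁, hloc⟩ := exists_ballShift_mul_gegMeasure_Icc_le hlam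
  obtain ⟨C₂, hC₂, hglob⟩ := exists_ballShift_mul_exp_le hlam
  obtain ⟨N, hN⟩ := exists_measure_le_of_forall_exists_closedBall
  refine ⟨N * C₁ + C₂ / (2 * lam), by positivity, fun f hf α hα => ?_⟩
  set μ := gegMeasure lam with hμ
  set I := ∫⁻ t, ‖f (Real.cosh t)‖ₑ ∂μ with hI
  rcases eq_or_ne I ∞ with hItop | hItop
  · rw [hItop, ENNReal.mul_top]
    · exact le_top
    · rw [ne_eq, ENNReal.ofReal_eq_zero, not_le]; positivity
  set E₁ := {x : ℝ | 0 < x ∧ ∃ r : ℝ, 0 < r ∧ r ≤ 1 ∧ ENNReal.ofReal α * μ (Ioo 0 r) ≤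
    ∫⁻ z, ‖f (Real.cosh z)‖ₑ * ballShift lam r x z ∂μ}
  set E₂ := {x : ℝ | 0 < x ∧ ∃ r : ℝ, 1 ≤ r ∧ ENNReal.ofReal α * μ (Ioo 0 r) ≤
    ∫⁻ z, ‖f (Real.cosh z)‖ₑ * ballShift lam r x z ∂μ}
  have hsub : {x | ENNReal.ofReal α < maximalG lam f x} ≤ᵐ[μ] (E₁ ∪ E₂ : Set ℝ) := by
    filter_upwards [ae_pos lam] with x hx hxα
    have hxα' : ENNReal.ofReal α < maximalG lam f x := hxα
    simp only [maximalG, lt_iSup_iff] at hxα'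
    obtain ⟨r, hr, h⟩ := hxα'
    rw [gegMeasure_ball_zero, setLIntegral_shift_eq lam r hx (fun z => ‖f z‖ₑ) hf, mul_comm,
      ← div_eq_mul_inv] at h
    have h' := (ENNReal.le_div_iff_mul_le (Or.inl (gegMeasure_Ioo_pos hlam hr).ne')
      (Or.inl (gegMeasure_Ioo_lt_top hlam hr).ne)).1 h.le
    rcases le_total r 1 with hr1 | hr1
    · exact Or.inl ⟨hx, r, hr, hr1, h'⟩
    · exact Or.inr ⟨hx, r, hr1, h'⟩
  have hα' : ENNReal.ofReal α ≠ 0 := by rw [ne_eq, ENNReal.ofReal_eq_zero, not_le]; exact hα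
  have h1 : μ E₁ ≤ ENNReal.ofReal (N * C₁ / α) * I := by
    have key : ENNReal.ofReal α * μ E₁ ≤ N * ∫⁻ t, ENNReal.ofReal C₁ * ‖f (Real.cosh t)‖ₑ ∂μ := by
      refine hN μ _ _ _ ?_
      rintro x ⟨hx, r, hr, hr1, h⟩
      refine ⟨r, hr, hr1, ?_⟩
      rw [Real.closedBall_eq_Icc]
      have hv0 := (gegMeasure_Ioo_pos hlam hr).ne'
      have hvt := (gegMeasure_Ioo_lt_top hlam hr).ne
      have hIcc : μ (Icc (x - r) (x + r)) ≠ ∞ :=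
        ((gegMeasure_Icc_le hlam (by linarith)).trans_lt ENNReal.ofReal_lt_top).ne
      rw [← ENNReal.mul_le_mul_iff_right hv0 hvt]
      calc μ (Ioo 0 r) * (ENNReal.ofReal α * μ (Icc (x - r) (x + r)))
          = ENNReal.ofReal α * μ (Ioo 0 r) * μ (Icc (x - r) (x + r)) := by ring
        _ ≤ (∫⁻ z, ‖f (Real.cosh z)‖ₑ * ballShift lam r x z ∂μ) * μ (Icc (x - r) (x + r)) := by
            gcongr
        _ = ∫⁻ z, ‖f (Real.cosh z)‖ₑ * ballShift lam r x z * μ (Icc (x - r) (x + r)) ∂μ :=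
            (lintegral_mul_const' _ _ hIcc).symm
        _ ≤ ∫⁻ z, μ (Ioo 0 r) * (Icc (x - r) (x + r)).indicator
              (fun z => ENNReal.ofReal C₁ * ‖f (Real.cosh z)‖ₑ) z ∂μ := by
            refine lintegral_mono_ae ?_
            filter_upwards [ae_pos lam] with z hz
            rcases le_or_gt r |x - z| with hxz | hxz
            · rw [ballShift_eq_zero lam hxz, mul_zero, zero_mul]; exact zero_le
            · have hxz' := abs_lt.1 hxz
              rw [indicator_of_mem (show z ∈ Icc (x - r) (x + r) from
                ⟨by linarith, by linarith⟩), mul_assoc]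
              calc _ ≤ ‖f (Real.cosh z)‖ₑ * (ENNReal.ofReal C₁ * μ (Ioo 0 r)) := by
                    exact mul_le_mul_right (hloc r x z hr hr1 hx hz hxz) _
                _ = _ := by ring
        _ = _ := by
            rw [lintegral_const_mul' _ _ hvt, lintegral_indicator measurableSet_Icc]
    rw [lintegral_const_mul' _ _ ENNReal.ofReal_ne_top, ← hI] at key
    rw [ENNReal.ofReal_div_of_pos hα, ENNReal.ofReal_mul (by positivity), ENNReal.ofReal_natCast,
      ENNReal.mul_div_right_comm.symm, ENNReal.le_div_iff_mul_le (Or.inl hα')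
      (Or.inl ENNReal.ofReal_ne_top)]
    calc _ = ENNReal.ofReal α * μ E₁ := mul_comm _ _
      _ ≤ _ := key
      _ = _ := by ring
  have h2 : μ E₂ ≤ ENNReal.ofReal (C₂ / (2 * lam) / α) * I := by
    -- on `E₂` the exponential `e^{2λx}` is bounded by `m`
    set m := C₂ * I.toReal / α with hm
    have hbound : ∀ x ∈ E₂, Real.exp (2 * lam * x) ≤ m := by
      rintro x ⟨hx, r, hr1, h⟩
      have hr : 0 < r := by linarith
      have hv0 := (gegMeasure_Ioo_pos hlam hr).ne'
      have hvt := (gegMeasure_Ioo_lt_top hlam hr).ne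
      have key : ENNReal.ofReal α * ENNReal.ofReal (Real.exp (2 * lam * x)) ≤
          ENNReal.ofReal C₂ * I := by
        rw [← ENNReal.mul_le_mul_iff_right hv0 hvt]
        calc μ (Ioo 0 r) * (ENNReal.ofReal α * ENNReal.ofReal (Real.exp (2 * lam * x)))
            = ENNReal.ofReal α * μ (Ioo 0 r) * ENNReal.ofReal (Real.exp (2 * lam * x)) := by ring
          _ ≤ (∫⁻ z, ‖f (Real.cosh z)‖ₑ * ballShift lam r x z ∂μ) *
                ENNReal.ofReal (Real.exp (2 * lam * x)) := by gcongr
          _ = ∫⁻ z, ‖f (Real.cosh z)‖ₑ * ballShift lam r x z *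
                ENNReal.ofReal (Real.exp (2 * lam * x)) ∂μ :=
              (lintegral_mul_const' _ _ ENNReal.ofReal_ne_top).symm
          _ ≤ ∫⁻ z, μ (Ioo 0 r) * ENNReal.ofReal C₂ * ‖f (Real.cosh z)‖ₑ ∂μ := by
              refine lintegral_mono_ae ?_
              filter_upwards [ae_pos lam] with z hz
              rw [mul_assoc]
              calc _ ≤ ‖f (Real.cosh z)‖ₑ * (ENNReal.ofReal C₂ * μ (Ioo 0 r)) := by
                    exact mul_le_mul_right (hglob r x z hr1 hx hz) _
                _ = _ := by ring
          _ = _ := by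
              rw [lintegral_const_mul' _ _ (ENNReal.mul_ne_top hvt ENNReal.ofReal_ne_top),
                mul_assoc]
      rw [← ENNReal.ofReal_toReal hItop, ← ENNReal.ofReal_mul hα.le, ← ENNReal.ofReal_mul hC₂.le,
        ENNReal.ofReal_le_ofReal_iff (by positivity)] at key
      rw [hm, le_div_iff₀ hα]
      linarith
    rcases E₂.eq_empty_or_nonempty with he | ⟨x₀, hx₀⟩
    · simp [he]
    have hmpos : 0 < m := (Real.exp_pos _).trans_le (hbound x₀ hx₀)
    have hE : E₂ ⊆ Iic (Real.log m / (2 * lam)) := fun x hx => by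
      rw [mem_Iic, le_div_iff₀ (by positivity), Real.le_log_iff_exp_le hmpos, mul_comm]
      exact hbound x hx
    calc _ ≤ _ := measure_mono hE
      _ ≤ _ := gegMeasure_Iic_le hlam _
      _ = ENNReal.ofReal (C₂ / (2 * lam) / α * I.toReal) := by
          rw [mul_div_cancel₀ _ (by positivity), Real.exp_log hmpos, hm]
          congr 1; ring
      _ = _ := by rw [ENNReal.ofReal_mul (by positivity), ENNReal.ofReal_toReal hItop]
  calc _ ≤ μ (E₁ ∪ E₂) := measure_mono_ae hsub
    _ ≤ μ E₁ + μ E₂ := measure_union_le _ _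
    _ ≤ _ := add_le_add h1 h2
    _ = _ := by rw [← add_mul, ← ENNReal.ofReal_add (by positivity) (by positivity), add_div]

/-! ### Interpolation with the uniform bound -/

/-- The maximal operator is bounded from `L^∞` to `L^∞`, in the form needed for interpolation:
removing from `f` its values of size at most `β` costs at most a multiple of `β`. -/
lemma exists_maximalG_le_add {lam : ℝ} (hlam : 0 < lam) :
    ∃ B : ℝ, 0 < B ∧ ∀ (f g : ℝ → ℂ) (β : ℝ), 0 ≤ β →
      (∀ z, ‖f z‖ₑ ≤ ‖g z‖ₑ + ENNReal.ofReal β) → ∀ x,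
      maximalG lam f x ≤ maximalG lam g x + ENNReal.ofReal (B * β) := by
  obtain ⟨S, hS, htot, -⟩ := exists_lintegral_sin_rpow_le hlam
  set c := Real.Gamma (lam + 1 / 2) / (Real.Gamma (1 / 2) * Real.Gamma lam) with hc
  have hc0 : 0 < c := Gamma_quotient_pos hlam
  refine ⟨c * S, by positivity, fun f g β hβ hfg x => ?_⟩
  have hshift (t : ℝ) : shift lam t (fun z => ‖f z‖ₑ) x ≤
      shift lam t (fun z => ‖g z‖ₑ) x + ENNReal.ofReal (c * S * β) := by
    rw [mul_assoc, ENNReal.ofReal_mul hc0.le, shift, shift, ← hc, ← mul_add]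
    refine mul_le_mul_right ?_ _
    calc _ ≤ ∫⁻ φ in Ioo 0 Real.pi,
          (‖g (Real.cosh x * Real.cosh t - Real.sinh x * Real.sinh t * Real.cos φ)‖ₑ *
            ENNReal.ofReal (Real.sin φ ^ (2 * lam - 1)) +
          ENNReal.ofReal β * ENNReal.ofReal (Real.sin φ ^ (2 * lam - 1))) := by
          refine lintegral_mono fun φ => ?_
          rw [← add_mul]
          gcongr
          exact hfg _
      _ ≤ _ := by
          rw [lintegral_add_right _ (by fun_prop), lintegral_const_mul' _ _ ENNReal.ofReal_ne_top,
            mul_comm S, ENNReal.ofReal_mul hβ]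
          gcongr
  refine iSup₂_le fun r hr => ?_
  have hv0 := (gegMeasure_Ioo_pos hlam hr).ne'
  have hvt := (gegMeasure_Ioo_lt_top hlam hr).ne
  calc _ ≤ (gegMeasure lam (ball 0 r))⁻¹ * ∫⁻ t in Ioo 0 r,
        (shift lam t (fun z => ‖g z‖ₑ) x + ENNReal.ofReal (c * S * β)) ∂(gegMeasure lam) := by
        gcongr with t; exact hshift t
    _ = (gegMeasure lam (ball 0 r))⁻¹ * (∫⁻ t in Ioo 0 r,
        shift lam t (fun z => ‖g z‖ₑ) x ∂(gegMeasure lam)) + ENNReal.ofReal (c * S * β) := by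
        rw [lintegral_add_right _ measurable_const, setLIntegral_const, mul_add,
          gegMeasure_ball_zero, mul_left_comm, ENNReal.inv_mul_cancel hv0 hvt, mul_one]
    _ ≤ _ := by
        gcongr
        exact le_iSup₂_of_le (f := fun (r : ℝ) (_ : 0 < r) => (gegMeasure lam (ball 0 r))⁻¹ *
          ∫⁻ t in Ioo 0 r, shift lam t (fun z => ‖g z‖ₑ) x ∂(gegMeasure lam)) r hr le_rfl

lemma setLIntegral_Ioo_mul_rpow {s : ℝ} (hs : 0 < s) {a : ℝ} (ha : 0 ≤ a) :
    ∫⁻ t in Ioo 0 a, ENNReal.ofReal (s * t ^ (s - 1)) = ENNReal.ofReal (a ^ s) := by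
  rw [← ofReal_integral_eq_lintegral_ofReal]
  · rw [← integral_Ioc_eq_integral_Ioo, ← intervalIntegral.integral_of_le ha,
      intervalIntegral.integral_const_mul, integral_rpow (Or.inl (by linarith)), sub_add_cancel,
      Real.zero_rpow hs.ne', sub_zero, mul_div_cancel₀ _ hs.ne']
  · have hi : IntervalIntegrable (fun φ : ℝ => s * φ ^ (s - 1)) volume 0 a :=
      (intervalIntegral.intervalIntegrable_rpow' (by linarith)).const_mul s
    rwa [intervalIntegrable_iff_integrableOn_Ioo_of_le ha] at hi
  · filter_upwards [ae_restrict_mem measurableSet_Ioo] with φ hφ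
    have := hφ.1
    simp only [Pi.zero_apply]
    positivity

/-- Layer cake inequality for a single extended nonnegative number, `y = ∞` included. -/
lemma rpow_le_setLIntegral_indicator {s : ℝ} (hs : 0 < s) (y : ℝ≥0∞) :
    y ^ s ≤ ∫⁻ t in Ioi (0 : ℝ), {t : ℝ | ENNReal.ofReal t < y}.indicator
      (fun t => ENNReal.ofReal (s * t ^ (s - 1))) t := by
  have hm : MeasurableSet {t : ℝ | ENNReal.ofReal t < y} :=
    measurableSet_lt (by fun_prop) measurable_const
  have key (a : ℝ) (ha : 0 ≤ a) (hay : ENNReal.ofReal a ≤ y) : ENNReal.ofReal (a ^ s) ≤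
      ∫⁻ t in Ioi (0 : ℝ), {t : ℝ | ENNReal.ofReal t < y}.indicator
      (fun t => ENNReal.ofReal (s * t ^ (s - 1))) t := by
    rw [← setLIntegral_Ioo_mul_rpow hs ha, setLIntegral_indicator hm]
    refine lintegral_mono_set fun t ht => ⟨?_, ht.1⟩
    exact ((ENNReal.ofReal_lt_ofReal_iff (ht.1.trans ht.2)).2 ht.2).trans_le hay
  rcases eq_or_ne y ∞ with rfl | hy
  · rw [ENNReal.top_rpow_of_pos hs, top_le_iff]
    refine ENNReal.eq_top_of_forall_nnreal_le fun n => ?_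
    refine le_trans ?_ (key ((n : ℝ) ^ s⁻¹) (by positivity) le_top)
    rw [Real.rpow_inv_rpow n.coe_nonneg hs.ne', ENNReal.ofReal_coe_nnreal]
  · have := key y.toReal ENNReal.toReal_nonneg (by rw [ENNReal.ofReal_toReal hy])
    rwa [← ENNReal.ofReal_rpow_of_nonneg ENNReal.toReal_nonneg hs.le, ENNReal.ofReal_toReal hy]
      at this

/-- The integration step of Marcinkiewicz interpolation between a weak `(1, 1)` and a strong
`(∞, ∞)` estimate. -/
lemma lintegral_rpow_le_of_weak_type {μ : Measure ℝ} [SFinite μ] {g h : ℝ → ℝ≥0∞}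
    (hg : AEMeasurable g μ) (hgt : ∀ x, g x ≠ ∞) (hh : AEMeasurable h μ) {K b s : ℝ} (hK : 0 ≤ K)
    (hb : 0 < b) (hs : 1 < s)
    (hweak : ∀ α : ℝ, 0 < α → μ {x | ENNReal.ofReal α < h x} ≤
      ENNReal.ofReal (K / α) * ∫⁻ x, {x | ENNReal.ofReal (α / b) < g x}.indicator g x ∂μ) :
    ∫⁻ x, h x ^ s ∂μ ≤ ENNReal.ofReal (K * s / (s - 1) * b ^ (s - 1)) * ∫⁻ x, g x ^ s ∂μ := by
  have hs0 : 0 < s := by linarith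
  have hs1 : 0 < s - 1 := by linarith
  calc ∫⁻ x, h x ^ s ∂μ
      ≤ ∫⁻ x, ∫⁻ t in Ioi (0 : ℝ), {t : ℝ | ENNReal.ofReal t < h x}.indicator
        (fun t => ENNReal.ofReal (s * t ^ (s - 1))) t ∂volume ∂μ :=
        lintegral_mono fun x => rpow_le_setLIntegral_indicator hs0 (h x)
    _ = ∫⁻ t in Ioi (0 : ℝ), ∫⁻ x, {t : ℝ | ENNReal.ofReal t < h x}.indicator
        (fun t => ENNReal.ofReal (s * t ^ (s - 1))) t ∂μ := by
        apply lintegral_lintegral_swap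
        have h1 : NullMeasurableSet {q : ℝ × ℝ | ENNReal.ofReal q.2 < h q.1}
            (μ.prod (volume.restrict (Ioi (0 : ℝ)))) :=
          nullMeasurableSet_lt (Measurable.aemeasurable (by fun_prop)) hh.comp_fst
        exact AEMeasurable.indicator₀ (f := fun q : ℝ × ℝ => ENNReal.ofReal (s * q.2 ^ (s - 1)))
          (Measurable.aemeasurable (by fun_prop)) h1
    _ = ∫⁻ t in Ioi (0 : ℝ), ENNReal.ofReal (s * t ^ (s - 1)) *
          μ {x | ENNReal.ofReal t < h x} := by
        refine lintegral_congr fun t => ?_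
        rw [← lintegral_indicator_const₀ (nullMeasurableSet_lt aemeasurable_const hh)]
        rfl
    _ ≤ ∫⁻ t in Ioi (0 : ℝ), ∫⁻ x, ENNReal.ofReal (K * s * t ^ (s - 1 - 1)) *
          {x | ENNReal.ofReal (t / b) < g x}.indicator g x ∂μ := by
        refine setLIntegral_mono' measurableSet_Ioi fun t ht => ?_
        have ht0 : 0 < t := ht
        rw [lintegral_const_mul' _ _ ENNReal.ofReal_ne_top]
        calc _ ≤ ENNReal.ofReal (s * t ^ (s - 1)) * (ENNReal.ofReal (K / t) * _) :=
              mul_le_mul_right (hweak t ht0) _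
          _ = _ := by
              rw [← mul_assoc, ← ENNReal.ofReal_mul (by positivity),
                Real.rpow_sub_one ht0.ne' (s - 1)]
              congr 2; ring
    _ = ∫⁻ x, ∫⁻ t in Ioi (0 : ℝ), ENNReal.ofReal (K * s * t ^ (s - 1 - 1)) *
          {x | ENNReal.ofReal (t / b) < g x}.indicator g x ∂volume ∂μ := by
        apply (lintegral_lintegral_swap _).symm
        have h1 : NullMeasurableSet {q : ℝ × ℝ | ENNReal.ofReal (q.2 / b) < g q.1}
            (μ.prod (volume.restrict (Ioi (0 : ℝ)))) :=
          nullMeasurableSet_lt (Measurable.aemeasurable (by fun_prop)) hg.comp_fst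
        exact AEMeasurable.mul (Measurable.aemeasurable (by fun_prop))
          (AEMeasurable.indicator₀ (f := fun q : ℝ × ℝ => g q.1) hg.comp_fst h1)
    _ = ∫⁻ x, ENNReal.ofReal (K * s / (s - 1) * b ^ (s - 1)) * g x ^ s ∂μ := by
        refine lintegral_congr fun x => ?_
        set a := (g x).toReal with ha
        have ha0 : 0 ≤ a := ENNReal.toReal_nonneg
        have hga : g x = ENNReal.ofReal a := (ENNReal.ofReal_toReal (hgt x)).symm
        calc _ = ∫⁻ t in Ioo 0 (b * a), ENNReal.ofReal (K * s / (s - 1) * a) *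
              ENNReal.ofReal ((s - 1) * t ^ (s - 1 - 1)) := by
              rw [← lintegral_indicator measurableSet_Ioi, ← lintegral_indicator measurableSet_Ioo]
              congr 1 with t
              by_cases ht : t ∈ Ioi 0
              swap
              · rw [indicator_of_notMem ht, indicator_of_notMem fun h' => ht h'.1]
              rw [indicator_of_mem ht]
              have ht0 : 0 < t := ht
              have hiff : ENNReal.ofReal (t / b) < g x ↔ t < b * a := by
                rw [hga, ENNReal.ofReal_lt_ofReal_iff_of_nonneg (by positivity),
                  div_lt_iff₀ hb, mul_comm]
              by_cases hta : t < b * a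
              · rw [indicator_of_mem (show t ∈ Ioo 0 (b * a) from ⟨ht0, hta⟩),
                  indicator_of_mem (show x ∈ {x | ENNReal.ofReal (t / b) < g x} from hiff.2 hta),
                  hga, ← ENNReal.ofReal_mul (by positivity), ← ENNReal.ofReal_mul (by positivity)]
                congr 1
                field_simp
              · rw [indicator_of_notMem (fun h' : t ∈ Ioo 0 (b * a) => hta h'.2),
                  indicator_of_notMem
                    (fun h' : x ∈ {x | ENNReal.ofReal (t / b) < g x} => hta (hiff.1 h')), mul_zero]
          _ = _ := by
              rw [lintegral_const_mul' _ _ ENNReal.ofReal_ne_top,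
                setLIntegral_Ioo_mul_rpow hs1 (by positivity), hga,
                ENNReal.ofReal_rpow_of_nonneg ha0 hs0.le, ← ENNReal.ofReal_mul (by positivity),
                ← ENNReal.ofReal_mul (by positivity), Real.mul_rpow hb.le ha0]
              congr 1
              rcases ha0.eq_or_lt with h0 | h0
              · rw [← h0, Real.zero_rpow hs0.ne']; ring
              · rw [Real.rpow_sub_one h0.ne']; field_simp
    _ = _ := lintegral_const_mul' _ _ ENNReal.ofReal_ne_top

end Gegenbauer

end

theorem theorem2 (lam : ℝ) (hlam : 0 < lam) :
    (∃ C : ℝ, 0 < C ∧ ∀ f : ℝ → ℂ, Gegenbauer.MemL 1 lam f → ∀ α : ℝ, 0 < α →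
      NullMeasurableSet {x : ℝ | 0 ≤ x ∧ ENNReal.ofReal α < Gegenbauer.maximalG lam f x}
        (Gegenbauer.gegMeasure lam) ∧
      Gegenbauer.gegMeasure lam {x : ℝ | 0 ≤ x ∧ ENNReal.ofReal α < Gegenbauer.maximalG lam f x} ≤
        ENNReal.ofReal (C / α) * Gegenbauer.normL 1 lam f) ∧
    (∀ p : ℝ≥0∞, 1 < p → p < ∞ → ∃ C : ℝ, 0 < C ∧ ∀ f : ℝ → ℂ, Gegenbauer.MemL p lam f →
      MemLp (fun x => Gegenbauer.maximalG lam f x) p (Gegenbauer.gegMeasure lam) ∧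
      eLpNorm (fun x => Gegenbauer.maximalG lam f x) p (Gegenbauer.gegMeasure lam) ≤
        ENNReal.ofReal C * Gegenbauer.normL p lam f) := by
  obtain ⟨C, hC, hweak⟩ := Gegenbauer.exists_weak_type_maximalG hlam
  refine ⟨⟨C, hC, fun f hf α hα => ⟨?_, ?_⟩⟩, fun p hp1 hpt => ?_⟩
  · exact measurableSet_Ici.nullMeasurableSet.inter (nullMeasurableSet_lt aemeasurable_const
      (Gegenbauer.aemeasurable_maximalG lam f hf.1.enorm))
  · rw [Gegenbauer.normL, eLpNorm_one_eq_lintegral_enorm]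
    exact (measure_mono fun x hx => hx.2).trans (hweak f hf.1.enorm α hα)
  · obtain ⟨B, hB, hbdd⟩ := Gegenbauer.exists_maximalG_le_add hlam
    have hp0 : p ≠ 0 := (zero_lt_one.trans hp1).ne'
    set s := p.toReal with hs
    have hs1 : 1 < s := by
      rw [hs, ← ENNReal.toReal_one]
      exact (ENNReal.toReal_lt_toReal ENNReal.one_ne_top hpt.ne).2 hp1
    have hs1' : 0 < s - 1 := by linarith
    set A := 2 * C * s / (s - 1) * (2 * B) ^ (s - 1) with hA
    have hA0 : 0 < A := by positivity
    refine ⟨A ^ (1 / s), by positivity, fun f hf => ?_⟩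
    have hmeas := Gegenbauer.aemeasurable_maximalG lam f hf.1.enorm
    have hle : eLpNorm (fun x => Gegenbauer.maximalG lam f x) p (Gegenbauer.gegMeasure lam) ≤
        ENNReal.ofReal (A ^ (1 / s)) * Gegenbauer.normL p lam f := by
      rw [Gegenbauer.normL, eLpNorm_eq_lintegral_rpow_enorm_toReal hp0 hpt.ne,
        eLpNorm_eq_lintegral_rpow_enorm_toReal hp0 hpt.ne, ← hs,
        ← ENNReal.ofReal_rpow_of_pos hA0, ← ENNReal.mul_rpow_of_nonneg _ _ (by positivity)]
      refine ENNReal.rpow_le_rpow ?_ (by positivity)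
      simp only [enorm_eq_self]
      refine Gegenbauer.lintegral_rpow_le_of_weak_type hf.1.enorm (fun _ => enorm_ne_top) hmeas
        (by positivity) (by positivity) hs1 fun α hα => ?_
      -- cutting off the values of `f` of size at most `α / (2B)` changes the maximal function by
      -- at most `α / 2`
      set g : ℝ → ℂ := {z | ENNReal.ofReal (α / (2 * B)) < ‖f z‖ₑ}.indicator f with hg
      have hgnorm (z : ℝ) : ‖g z‖ₑ =
          {z | ENNReal.ofReal (α / (2 * B)) < ‖f z‖ₑ}.indicator (fun z => ‖f z‖ₑ) z := by
        rw [hg, enorm_indicator_eq_indicator_enorm]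
      have hgm : AEMeasurable (fun t => ‖g (Real.cosh t)‖ₑ) (Gegenbauer.gegMeasure lam) := by
        simp only [hgnorm]
        exact AEMeasurable.indicator₀ (f := fun t => ‖f (Real.cosh t)‖ₑ) hf.1.enorm
          (nullMeasurableSet_lt aemeasurable_const hf.1.enorm)
      have hfg (z : ℝ) : ‖f z‖ₑ ≤ ‖g z‖ₑ + ENNReal.ofReal (α / (2 * B)) := by
        rw [hgnorm]
        by_cases hz : ENNReal.ofReal (α / (2 * B)) < ‖f z‖ₑ
        · rw [indicator_of_mem (show z ∈ {z | ENNReal.ofReal (α / (2 * B)) < ‖f z‖ₑ} from hz)]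
          exact le_self_add
        · exact (not_lt.1 hz).trans le_add_self
      have hsub : {x | ENNReal.ofReal α < Gegenbauer.maximalG lam f x} ⊆
          {x | ENNReal.ofReal (α / 2) < Gegenbauer.maximalG lam g x} := by
        intro x hx
        have h1 := lt_of_lt_of_le hx (hbdd f g _ (by positivity) hfg x)
        rw [show B * (α / (2 * B)) = α / 2 by field_simp] at h1
        rw [show α = α / 2 + α / 2 by ring, ENNReal.ofReal_add (by positivity) (by positivity),
          show (α / 2 + α / 2) / 2 = α / 2 by ring] at h1
        exact lt_of_add_lt_add_right h1
      calc _ ≤ _ := measure_mono hsub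
        _ ≤ _ := hweak g hgm (α / 2) (by positivity)
        _ = _ := by
          simp only [hgnorm]
          rw [show C / (α / 2) = 2 * C / α by field_simp]
          rfl
    exact ⟨⟨hmeas.aestronglyMeasurable,
      hle.trans_lt (ENNReal.mul_lt_top ENNReal.ofReal_lt_top hf.2)⟩, hle⟩
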